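/- Let $r>s\ge 2$ be integers. Let $B_{r,s}$ be the graph consisting of two copies of $K_r$ which share exactly $s$ vertices, and let $ex(n,K_r,B_{r,s})$ be the maximum number of copies of $K_r$ in a graph on $n$ vertices that does not contain $B_{r,s}$ as a (not necessarily induced) subgraph. A partition $(a_1,\ldots,a_t)$ of $r$, with $a_1\ge\cdots\ge a_t>0$ integers and $\sum_{i=1}^t a_i=r$, is called $s$-sum-free if $\sum_{i\in I}a_i\ne s$ for every $I\subseteq\{1,\ldots,t\}$; let $\beta_{r,s}$ be the maximum length $t$ of an $s$-sum-free partition of $r$. (i) If $r\ge 2s+1$, then $ex(n,K_r,B_{r,s})=\Theta(n^{r-s-1})$ as $n\to\infty$. (ii) If $r\le 2s$, then there exist positive reals $c_1$ and $c_2$, depending only on $r$ and $s$, such that for every integer $n\ge r$ $$c_1 n^{\beta_{r,s}}\le ex(n,K_r,B_{r,s})\le c_2 n^{s}.$$ -/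

import Mathlib

open Filter Asymptotics

/-- The graph `B_{r,s}` (for `s ≤ r`) consisting of two copies of `K_r` that share exactly `s`
vertices. Its `2 * r - s` vertices are `0, …, 2 * r - s - 1`; one copy of `K_r` sits on the first
`r` vertices, the other one on the last `r` vertices `r - s, …, 2 * r - s - 1`. -/
def intersectingCliques (r s : ℕ) : SimpleGraph (Fin (2 * r - s)) where
  Adj u v := u ≠ v ∧
    (((u : ℕ) < r ∧ (v : ℕ) < r) ∨ (r - s ≤ (u : ℕ) ∧ r - s ≤ (v : ℕ)))
  symm := ⟨fun _ _ h => ⟨h.1.symm, h.2.imp And.symm And.symm⟩⟩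
  loopless := ⟨fun _ h => h.1 rfl⟩

open Classical in
/-- The generalized Turán number `ex(n, T, F)`: the maximum number of (unlabelled) copies of `T`
in a graph on `n` vertices which does not contain `F` as a (not necessarily induced) subgraph. -/
noncomputable def generalizedTuranNumber {U W : Type*} (n : ℕ) (T : SimpleGraph U)
    (F : SimpleGraph W) : ℕ :=
  Finset.sup {G : SimpleGraph (Fin n) | F.Free G} (fun G => G.copyCount T)

/-- A partition of `r` is `s`-sum-free if no subfamily of its parts has sum `s`. -/
def Nat.Partition.IsSumFree {r : ℕ} (s : ℕ) (P : r.Partition) : Prop :=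
  ∀ t ≤ P.parts, t.sum ≠ s

open Classical in
/-- `β_{r,s}`: the maximum length (number of parts) of an `s`-sum-free partition of `r`. -/
noncomputable def maxSumFreeLength (r s : ℕ) : ℕ :=
  Finset.sup {P : r.Partition | P.IsSumFree s} (fun P => P.parts.card)

/-! Upper bound: labelled copies of `K_r` in a `B_{r,s}`-free graph are functions, no two of which
agree on `s` labels and take disjoint values elsewhere. `exists_homogeneous_subfamily` keeps a
constant proportion of them whose agreement sets are all kernel types. Kernel types combine, so
these sets are closed under intersection, and none has size `s`. `exists_card_le_forall_not_subset`,
which rests on the Frankl–Katona theorem, then gives a set `T` of at most `max s (r - s - 1)` labels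
contained in no agreement set: a function of the subfamily is determined by its values on `T`.

Lower bounds: an `r`-clique of `blockGraph` is a choice of block for each colour, and the colours
shared by two cliques form a union of `σ`-classes containing `R`. Freezing `s + 1` colours, or
grouping colours along an `s`-sum-free partition, excludes size `s` and leaves `r - s - 1`,
respectively `β_{r,s}`, free choices among `n / r` blocks. -/

/-! ### Bipartite graphs and intersection-closed families. -/

/-- If a bipartite graph on `T` and `D` with `#T = #D + 1` has no vertex of `T` adjacent to all of
`D`, then some non-adjacent `t ∈ T` and `x ∈ D` satisfy `deg x ≤ deg t`. -/
theorem exists_notMem_card_filter_le {α β : Type*} [DecidableEq β]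
    {T : Finset α} {D : Finset β} {V : α → Finset β} (hV : ∀ t ∈ T, V t ⊂ D)
    (hcard : D.card + 1 = T.card) :
    ∃ t ∈ T, ∃ x ∈ D, x ∉ V t ∧ (T.filter fun t' => x ∈ V t').card ≤ (V t).card := by
  by_contra! hcon
  have hpart : ∀ x, (T.filter fun t => x ∉ V t).card + (T.filter fun t => x ∈ V t).card = T.card :=
    fun x => by rw [add_comm, Finset.card_filter_add_card_filter_not]
  -- Non-adjacent pairs are weighted so that each `t` has total weight 1. If `deg t < deg x` for all
  -- of them, replacing the weight by the inverse of the number of non-neighbours of `x` only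
  -- increases it, and each `x` then has total at most 1.
  have h1 : (T.card : ℚ) = ∑ t ∈ T, ∑ x ∈ D with x ∉ V t, (1 : ℚ) / (D \ V t).card := by
    rw [Finset.card_eq_sum_ones, Nat.cast_sum]
    refine Finset.sum_congr rfl fun t ht => ?_
    rw [← Finset.sdiff_eq_filter, Finset.sum_const, nsmul_eq_mul]
    have : (0 : ℚ) < (D \ V t).card := by
      have := Finset.sdiff_nonempty.2 (hV t ht).2
      exact_mod_cast this.card_pos
    field_simp
    simp
  have h2 : ∑ t ∈ T, ∑ x ∈ D with x ∉ V t, (1 : ℚ) / (D \ V t).card ≤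
      ∑ t ∈ T, ∑ x ∈ D with x ∉ V t, (1 : ℚ) / (T.filter fun t => x ∉ V t).card := by
    refine Finset.sum_le_sum fun t ht => Finset.sum_le_sum fun x hx => ?_
    rw [Finset.mem_filter] at hx
    have hpos : 0 < (T.filter fun t => x ∉ V t).card :=
      Finset.card_pos.2 ⟨t, Finset.mem_filter.2 ⟨ht, hx.2⟩⟩
    refine one_div_le_one_div_of_le (by exact_mod_cast hpos) ?_
    have h3 := hcon t ht x hx.1 hx.2
    have h4 := Finset.card_sdiff_add_card_eq_card (hV t ht).1
    have h5 := hpart x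
    have : (T.filter fun t => x ∉ V t).card ≤ (D \ V t).card := by omega
    exact_mod_cast this
  have h3 : ∑ t ∈ T, ∑ x ∈ D with x ∉ V t, (1 : ℚ) / (T.filter fun t => x ∉ V t).card =
      ∑ x ∈ D, ∑ t ∈ T with x ∉ V t, (1 : ℚ) / (T.filter fun t => x ∉ V t).card := by
    simp only [Finset.sum_filter]
    exact Finset.sum_comm
  have h4 : ∑ x ∈ D, ∑ t ∈ T with x ∉ V t, (1 : ℚ) / (T.filter fun t => x ∉ V t).card ≤
      D.card := by
    rw [Finset.card_eq_sum_ones, Nat.cast_sum]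
    refine Finset.sum_le_sum fun x _ => ?_
    rw [Finset.sum_const, nsmul_eq_mul, mul_one_div]
    simpa using div_self_le_one (_ : ℚ)
  have h5 : (T.card : ℚ) ≤ D.card := by rw [h1]; exact (h2.trans h3.le).trans h4
  have h6 : T.card ≤ D.card := by exact_mod_cast h5
  omega

/-- Selecting `t` uses up `1 + #(V t)` elements; the rest is counted in the graph with `V t`
deleted. This is the induction step below. -/
theorem card_insert_add_card_biUnion {α β : Type*} [DecidableEq α] [DecidableEq β]
    {V : α → Finset β} {t : α} {A : Finset α} (ht : t ∉ A) :
    (insert t A).card + ((insert t A).biUnion V).card =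
      A.card + (A.biUnion fun t' => V t' \ V t).card + 1 + (V t).card := by
  rw [Finset.card_insert_of_notMem ht, Finset.biUnion_insert, ← Finset.union_sdiff_self_eq_union,
    Finset.card_union_of_disjoint Finset.disjoint_sdiff]
  have : A.biUnion V \ V t = A.biUnion fun t' => V t' \ V t := by
    ext x; simp only [Finset.mem_sdiff, Finset.mem_biUnion]; tauto
  rw [this]; omega

/-- A theorem of Frankl and Katona: in a bipartite graph on `T` and `D` with `#D < u ≤ #T`, some
subset of `T` together with its neighbourhood has exactly `u` elements. -/
theorem exists_card_add_card_biUnion_eq {α β : Type*} [DecidableEq α] [DecidableEq β] (u : ℕ) :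
    ∀ (T : Finset α) (D : Finset β) (V : α → Finset β), (∀ t ∈ T, V t ⊆ D) → D.card < u →
      u ≤ T.card → ∃ A ⊆ T, A.card + (A.biUnion V).card = u := by
  induction u using Nat.strong_induction_on with
  | _ u ih =>
  intro T D V hV hD hT
  obtain ⟨T₀, hT₀, rfl⟩ := Finset.exists_subset_card_eq hT
  replace hV : ∀ t ∈ T₀, V t ⊆ D := fun t ht => hV t (hT₀ ht)
  suffices h : ∃ A ⊆ T₀, A.card + (A.biUnion V).card = T₀.card by
    obtain ⟨A, hA, h⟩ := h
    exact ⟨A, hA.trans hT₀, h⟩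
  clear hT hT₀ T
  -- With `#T₀ > #D + 1` there is slack, so any `t` can be selected.
  rcases Nat.lt_or_ge (D.card + 1) T₀.card with hlt | hge
  · obtain ⟨t, ht⟩ := Finset.card_pos.1 (by omega : 0 < T₀.card)
    have h1 := Finset.card_sdiff_add_card_eq_card (hV t ht)
    have h2 := Finset.card_erase_of_mem ht
    obtain ⟨A, hA, hcard⟩ := ih (T₀.card - 1 - (V t).card) (by omega) (T₀.erase t) (D \ V t)
      (fun t' => V t' \ V t)
      (fun t' ht' => Finset.sdiff_subset_sdiff (hV t' (Finset.mem_of_mem_erase ht')) le_rfl)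
      (by omega) (by omega)
    have htA : t ∉ A := fun h => Finset.notMem_erase t _ (hA h)
    refine ⟨insert t A, Finset.insert_subset ht (hA.trans (Finset.erase_subset _ _)), ?_⟩
    rw [card_insert_add_card_biUnion htA, hcard]
    omega
  · by_cases hfull : ∃ t ∈ T₀, V t = D
    · obtain ⟨t, ht, hVt⟩ := hfull
      refine ⟨{t}, by simpa using ht, ?_⟩
      rw [Finset.singleton_biUnion, hVt, Finset.card_singleton]
      omega
    push Not at hfull
    -- Here `#T₀ = #D + 1`, so after selecting `t` the right side must lose one more vertex, `x`.
    -- Its neighbours are discarded with it; `deg x ≤ deg t` ensures that enough of `T₀` remains.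
    obtain ⟨t, ht, x, hx, hxt, hdeg⟩ := exists_notMem_card_filter_le (T := T₀) (D := D) (V := V)
      (fun t ht => (hV t ht).ssubset_of_ne (hfull t ht)) (by omega)
    have h1 := Finset.card_sdiff_add_card_eq_card (hV t ht)
    have hxD : x ∈ D \ V t := Finset.mem_sdiff.2 ⟨hx, hxt⟩
    have h2 := Finset.card_erase_of_mem hxD
    have h2' := Finset.card_pos.2 ⟨x, hxD⟩
    have h3 : (T₀.filter fun t' => x ∈ V t').card + (T₀.filter fun t' => x ∉ V t').card = T₀.card :=
      Finset.card_filter_add_card_filter_not _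
    have h4 := Finset.card_erase_of_mem
      (Finset.mem_filter.2 ⟨ht, hxt⟩ : t ∈ T₀.filter fun t' => x ∉ V t')
    obtain ⟨A, hA, hcard⟩ := ih (T₀.card - 1 - (V t).card) (by omega)
      ((T₀.filter fun t' => x ∉ V t').erase t) ((D \ V t).erase x) (fun t' => V t' \ V t)
      (fun t' ht' => by
        have h := Finset.mem_filter.1 (Finset.mem_of_mem_erase ht')
        refine Finset.subset_erase.2 ⟨Finset.sdiff_subset_sdiff (hV t' h.1) le_rfl, fun hx' => ?_⟩
        exact h.2 (Finset.mem_sdiff.1 hx').1)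
      (by omega) (by omega)
    have htA : t ∉ A := fun h => Finset.notMem_erase t _ (hA h)
    refine ⟨insert t A, Finset.insert_subset ht
      (hA.trans ((Finset.erase_subset _ _).trans (Finset.filter_subset _ _))), ?_⟩
    rw [card_insert_add_card_biUnion htA, hcard]
    omega

/-- An intersection-closed family of proper subsets of `ι` with no member of size `s` leaves some
set of size at most `max s (#ι - s - 1)` uncovered. -/
theorem exists_card_le_forall_not_subset {ι : Type*} [Fintype ι] [DecidableEq ι]
    {J : Finset (Finset ι)} {s : ℕ} (hs : s < Fintype.card ι)
    (hproper : ∀ A ∈ J, A ≠ Finset.univ) (hinter : ∀ A ∈ J, ∀ B ∈ J, A ∩ B ∈ J)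
    (hcard : ∀ A ∈ J, A.card ≠ s) :
    ∃ T : Finset ι, T.card ≤ max s (Fintype.card ι - s - 1) ∧ ∀ A ∈ J, ¬ T ⊆ A := by
  -- For a minimal `T`, each `t ∈ T` has a member `K t` of `J` that meets `T` in exactly `T.erase
  -- t`.
  obtain ⟨T, hT, hmin⟩ := Finset.exists_min_image
    (Finset.univ.filter fun T : Finset ι => ∀ A ∈ J, ¬ T ⊆ A) Finset.card
    ⟨Finset.univ, by simpa [Finset.univ_subset_iff] using hproper⟩
  simp only [Finset.mem_filter, Finset.mem_univ, true_and] at hT hmin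
  refine ⟨T, ?_, hT⟩
  by_contra! hlt
  have hex : ∀ t, ∃ A, t ∈ T → A ∈ J ∧ T.erase t ⊆ A := by
    intro t
    by_contra! h
    have ht := (h ∅).1
    have := hmin (T.erase t) fun A hA hsub => (h A).2 hA hsub
    rw [Finset.card_erase_of_mem ht] at this
    have := Finset.card_pos.2 ⟨t, ht⟩
    omega
  choose K hK using hex
  have htK : ∀ t ∈ T, t ∉ K t := fun t ht h => hT _ (hK t ht).1 <| by
    rw [← Finset.insert_erase ht]; exact Finset.insert_subset h (hK t ht).2
  have hcompl := Finset.card_add_card_compl T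
  -- Joining `t` to the points outside both `T` and `K t`, a vertex set `A` together with its
  -- neighbourhood is the complement of the intersection of the `K t`, `t ∈ A`. Size `#ι - s` thus
  -- produces a member of size `s`.
  obtain ⟨A, hA, hAcard⟩ := exists_card_add_card_biUnion_eq (Fintype.card ι - s) T Tᶜ
    (fun t => Tᶜ \ K t) (fun _ _ => Finset.sdiff_subset) (by omega) (by omega)
  have hAne : A.Nonempty := by
    rw [Finset.nonempty_iff_ne_empty]
    rintro rfl
    simp at hAcard
    omega
  have hmem : A.inf' hAne K ∈ J :=
    Finset.inf'_mem (J : Set (Finset ι)) (fun A hA B hB => hinter A hA B hB) _ _ _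
      fun t ht => (hK t (hA ht)).1
  refine hcard _ hmem ?_
  have heq : (A.inf' hAne K)ᶜ = A ∪ A.biUnion fun t => Tᶜ \ K t := by
    ext x
    have hx : x ∈ A.inf' hAne K ↔ ∀ t ∈ A, x ∈ K t := by
      rw [← Finset.singleton_subset_iff, Finset.le_inf'_iff]
      simp
    simp only [Finset.mem_compl, hx, Finset.mem_union, Finset.mem_biUnion, Finset.mem_sdiff]
    push Not
    constructor
    · rintro ⟨t, ht, hxt⟩
      by_cases hxT : x ∈ T
      · by_cases hxe : x = t
        · exact Or.inl (hxe ▸ ht)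
        · exact absurd ((hK t (hA ht)).2 (Finset.mem_erase.2 ⟨hxe, hxT⟩)) hxt
      · exact Or.inr ⟨t, ht, hxT, hxt⟩
    · rintro (hxA | ⟨t, ht, -, hxt⟩)
      · exact ⟨x, hxA, htK x (hA hxA)⟩
      · exact ⟨t, ht, hxt⟩
  have hdisj : Disjoint A (A.biUnion fun t => Tᶜ \ K t) := by
    rw [Finset.disjoint_left]
    intro x hx hx'
    obtain ⟨t, -, h⟩ := Finset.mem_biUnion.1 hx'
    exact Finset.mem_compl.1 (Finset.mem_sdiff.1 h).1 (hA hx)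
  have := Finset.card_add_card_compl (A.inf' hAne K)
  rw [heq, Finset.card_union_of_disjoint hdisj, hAcard] at this
  omega

/-! ### Homogeneous subfamilies and the Frankl–Füredi bound. -/

/-- The set of arguments at which two functions agree. -/
def agreeSet {ι V : Type*} [Fintype ι] [DecidableEq V] (f g : ι → V) : Finset ι :=
  Finset.univ.filter fun i => f i = g i

theorem mem_agreeSet {ι V : Type*} [Fintype ι] [DecidableEq V] {f g : ι → V} {i : ι} :
    i ∈ agreeSet f g ↔ f i = g i := by
  simp [agreeSet]

/-- `A` is a kernel type of the family `𝓕`: every member of `𝓕` can be modified outside `A`, within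
`𝓕`, in such a way that its new values avoid any `κ`-indexed collection of forbidden values. -/
def IsKernelType {ι V : Type*} (κ : Type*) (𝓕 : Finset (ι → V)) (A : Finset ι) : Prop :=
  ∀ f ∈ 𝓕, ∀ z : κ → V, ∃ g ∈ 𝓕, (∀ i ∈ A, g i = f i) ∧ ∀ j ∉ A, ∀ k, g j ≠ z k

/-- The members of `𝓕` having a prescribed restriction to `A` are pierced outside `A` by a
`κ`-indexed collection of values. -/
def IsPiercedType {ι V : Type*} (κ : Type*) (𝓕 : Finset (ι → V)) (A : Finset ι) : Prop :=
  ∀ f ∈ 𝓕, ∃ z : κ → V, ∀ g ∈ 𝓕, (∀ i ∈ A, g i = f i) → ∃ j ∉ A, ∃ k, g j = z k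

/-- Functions agreeing with `f` on `A` are pierced by `z`; for the others `f` is irrelevant and the
old piercing still works. -/
theorem IsPiercedType.insert {ι V κ : Type*} [DecidableEq (ι → V)] {𝓗 : Finset (ι → V)}
    {A : Finset ι} (h : IsPiercedType κ 𝓗 A) {f : ι → V} {z : κ → V}
    (hz : ∀ g ∈ insert f 𝓗, (∀ i ∈ A, g i = f i) → ∃ j ∉ A, ∃ k, g j = z k) :
    IsPiercedType κ (insert f 𝓗) A := by
  intro g hg
  by_cases hgf : ∀ i ∈ A, g i = f i
  · exact ⟨z, fun g' hg' h' => hz g' hg' fun i hi => (h' i hi).trans (hgf i hi)⟩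
  · have hg' : g ∈ 𝓗 := (Finset.mem_insert.1 hg).resolve_left fun h => hgf fun _ _ => by rw [h]
    obtain ⟨y, hy⟩ := h g hg'
    refine ⟨y, fun g' hg' h' => ?_⟩
    rcases Finset.mem_insert.1 hg' with rfl | hg'
    · exact absurd (fun i hi => (h' i hi).symm) hgf
    · exact hy g' hg' h'

/-- A family splits into a part for which all the types in `J` are kernel types, and one part for
each `A ∈ J` for which `A` is a pierced type. -/
theorem exists_kernelType_pierced_decomposition {ι V : Type*} (κ : Type*) [DecidableEq ι]
    [DecidableEq (ι → V)] (J : Finset (Finset ι)) (𝓕 : Finset (ι → V)) :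
    ∃ 𝓖 ⊆ 𝓕, ∃ 𝓗 : Finset ι → Finset (ι → V), (∀ A, 𝓗 A ⊆ 𝓕) ∧ 𝓕 ⊆ 𝓖 ∪ J.biUnion 𝓗 ∧
      (∀ A ∈ J, IsKernelType κ 𝓖 A) ∧ ∀ A, IsPiercedType κ (𝓗 A) A := by
  induction 𝓕 using Finset.strongInduction with
  | _ 𝓕 ih =>
  by_cases hker : ∀ A ∈ J, IsKernelType κ 𝓕 A
  · exact ⟨𝓕, le_rfl, fun _ => ∅, fun _ => Finset.empty_subset _, Finset.subset_union_left, hker,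
      fun _ f hf => absurd hf (Finset.notMem_empty f)⟩
  unfold IsKernelType at hker
  push Not at hker
  obtain ⟨A, hA, f, hf, z, hz⟩ := hker
  -- A failure of the kernel property at `f` is precisely a piercing of the members that agree with
  -- `f` on `A`, so `f` is moved to `𝓗 A`.
  obtain ⟨𝓖, h𝓖, 𝓗, h𝓗, hcov, hgood, hbad⟩ := ih _ (Finset.erase_ssubset hf)
  have hsub : insert f (𝓗 A) ⊆ 𝓕 :=
    Finset.insert_subset hf ((h𝓗 A).trans (Finset.erase_subset _ _))
  refine ⟨𝓖, h𝓖.trans (Finset.erase_subset _ _), Function.update 𝓗 A (insert f (𝓗 A)),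
    fun B => ?_, fun g hg => ?_, hgood, fun B => ?_⟩
  · rcases eq_or_ne B A with rfl | hB
    · rwa [Function.update_self]
    · rw [Function.update_of_ne hB]
      exact (h𝓗 B).trans (Finset.erase_subset _ _)
  · rcases eq_or_ne g f with rfl | hgf
    · exact Finset.mem_union_right _ (Finset.mem_biUnion.2 ⟨A, hA, by simp⟩)
    · rcases Finset.mem_union.1 (hcov (Finset.mem_erase.2 ⟨hgf, hg⟩)) with h | h
      · exact Finset.mem_union_left _ h
      · obtain ⟨B, hB, hgB⟩ := Finset.mem_biUnion.1 h
        refine Finset.mem_union_right _ (Finset.mem_biUnion.2 ⟨B, hB, ?_⟩)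
        rcases eq_or_ne B A with rfl | hBA
        · rw [Function.update_self]; exact Finset.mem_insert_of_mem hgB
        · rwa [Function.update_of_ne hBA]
  · rcases eq_or_ne B A with rfl | hB
    · rw [Function.update_self]
      exact (hbad B).insert fun g hg => hz g (hsub hg)
    · rw [Function.update_of_ne hB]
      exact hbad B

/-- A family for which `A` is a pierced type has a large subfamily in which no two members agree
exactly on `A`. -/
theorem IsPiercedType.exists_subset_agreeSet_ne {ι V κ : Type*} [Fintype ι] [Fintype κ]
    [DecidableEq ι] [DecidableEq V] [Nonempty (ι × κ)] [Nonempty V] {𝓗 : Finset (ι → V)}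
    {A : Finset ι} (h : IsPiercedType κ 𝓗 A) :
    ∃ 𝓚 ⊆ 𝓗, 𝓗.card ≤ Fintype.card (ι × κ) * 𝓚.card ∧
      ∀ f ∈ 𝓚, ∀ g ∈ 𝓚, agreeSet f g ≠ A := by
  classical
  -- The piercing values depend only on the restriction to `A`. Hence two functions that agree on
  -- `A` and are hit at the same `(j, k)` also agree at `j ∉ A`; pigeonholing over `(j, k)`
  -- finishes.
  have hex : ∀ x : {i // i ∈ A} → V, ∃ z : κ → V, ∀ g ∈ 𝓗, (∀ i : {i // i ∈ A}, g i = x i) →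
      ∃ j ∉ A, ∃ k, g j = z k := by
    intro x
    by_cases hx : ∃ f ∈ 𝓗, ∀ i : {i // i ∈ A}, f i = x i
    · obtain ⟨f, hf, hfx⟩ := hx
      obtain ⟨z, hz⟩ := h f hf
      exact ⟨z, fun g hg hgx => hz g hg fun i hi => (hgx ⟨i, hi⟩).trans (hfx ⟨i, hi⟩).symm⟩
    · exact ⟨fun _ => Classical.arbitrary V, fun g hg hgx => absurd ⟨g, hg, hgx⟩ hx⟩
  choose z hz using hex
  have hex' : ∀ f : ι → V, ∃ p : ι × κ, f ∈ 𝓗 → p.1 ∉ A ∧ f p.1 = z (fun i => f i) p.2 := by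
    intro f
    by_cases hf : f ∈ 𝓗
    · obtain ⟨j, hj, k, hk⟩ := hz (fun i => f i) f hf fun _ => rfl
      exact ⟨(j, k), fun _ => ⟨hj, hk⟩⟩
    · exact ⟨Classical.arbitrary _, fun h => absurd h hf⟩
  choose p hp using hex'
  obtain ⟨c, -, hc⟩ := Finset.exists_max_image (Finset.univ : Finset (ι × κ))
    (fun c => (𝓗.filter fun f => p f = c).card) Finset.univ_nonempty
  refine ⟨𝓗.filter fun f => p f = c, Finset.filter_subset _ _, ?_, ?_⟩
  · rw [Finset.card_eq_sum_card_fiberwise (fun f _ => Finset.mem_univ (p f)), ← Finset.card_univ,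
      ← smul_eq_mul]
    exact Finset.sum_le_card_nsmul _ _ _ hc
  · intro f hf g hg hfg
    rw [Finset.mem_filter] at hf hg
    have hf' := hp f hf.1
    have hg' := hp g hg.1
    rw [hf.2] at hf'
    rw [hg.2] at hg'
    have hrestr : (fun i : {i // i ∈ A} => f i) = fun i : {i // i ∈ A} => g i :=
      funext fun i => mem_agreeSet.1 (hfg ▸ i.2)
    refine hf'.1 (hfg ▸ mem_agreeSet.2 ?_)
    rw [hf'.2, hg'.2, hrestr]

/-- A form of Füredi's theorem on homogeneous subfamilies: every family of functions contains a
positive proportion subfamily such that every type of agreement occurring in it is a kernel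
type. -/
theorem exists_homogeneous_subfamily (ι κ : Type*) [Fintype ι] [Fintype κ] [DecidableEq ι]
    [Nonempty (ι × κ)] (m : ℕ) :
    ∃ C : ℕ, ∀ (V : Type) [DecidableEq V] [Nonempty V] (J : Finset (Finset ι))
      (𝓕 : Finset (ι → V)), J.card = m → (∀ f ∈ 𝓕, ∀ g ∈ 𝓕, f ≠ g → agreeSet f g ∈ J) →
      ∃ 𝓖 ⊆ 𝓕, ∃ J' ⊆ J, 𝓕.card ≤ C * 𝓖.card ∧
        (∀ f ∈ 𝓖, ∀ g ∈ 𝓖, f ≠ g → agreeSet f g ∈ J') ∧ ∀ A ∈ J', IsKernelType κ 𝓖 A := by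
  induction m with
  | zero =>
    refine ⟨1, fun V _ _ J 𝓕 hJ h𝓕 => ⟨𝓕, le_rfl, J, le_rfl, by simp, h𝓕, ?_⟩⟩
    rw [Finset.card_eq_zero] at hJ
    simp [hJ]
  | succ m ih =>
    obtain ⟨C, hC⟩ := ih
    -- There are `m + 2` pieces: `𝓖` and one for each of the `m + 1` types. The summand 1 serves the
    -- case of a large `𝓖`; the other, that of a large `𝓗 A`, where type `A` is eliminated and the
    -- induction applies.
    refine ⟨(m + 2) * (1 + Fintype.card (ι × κ) * C), fun V _ _ J 𝓕 hJ h𝓕 => ?_⟩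
    obtain ⟨𝓖, h𝓖, 𝓗, h𝓗, hcov, hgood, hbad⟩ := exists_kernelType_pierced_decomposition κ J 𝓕
    by_cases hlarge : 𝓕.card ≤ (m + 2) * 𝓖.card
    · refine ⟨𝓖, h𝓖, J, le_rfl, hlarge.trans ?_, fun f hf g hg => h𝓕 f (h𝓖 hf) g (h𝓖 hg), hgood⟩
      exact Nat.mul_le_mul_right _ (Nat.le_mul_of_pos_right _ (by omega))
    obtain ⟨A, hA, hAcard⟩ : ∃ A ∈ J, 𝓕.card ≤ (m + 2) * (𝓗 A).card := by
      by_contra! hsmall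
      have h1 := (Finset.card_le_card hcov).trans
        ((Finset.card_union_le _ _).trans (Nat.add_le_add_left Finset.card_biUnion_le _))
      have h2 : ∑ A ∈ J, (m + 2) * (𝓗 A).card ≤ (m + 1) * 𝓕.card := by
        rw [← hJ, ← smul_eq_mul]
        exact Finset.sum_le_card_nsmul _ _ _ fun A hA => (hsmall A hA).le
      rw [← Finset.mul_sum] at h2
      nlinarith
    obtain ⟨𝓚, h𝓚, hcard, hne⟩ := (hbad A).exists_subset_agreeSet_ne
    have h𝓚𝓕 : 𝓚 ⊆ 𝓕 := h𝓚.trans (h𝓗 A)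
    obtain ⟨𝓖', h𝓖', J', hJ', hcard', hJ'', hgood'⟩ := hC V (J.erase A) 𝓚
      (by rw [Finset.card_erase_of_mem hA, hJ]; rfl)
      (fun f hf g hg hfg => Finset.mem_erase.2 ⟨hne f hf g hg, h𝓕 f (h𝓚𝓕 hf) g (h𝓚𝓕 hg) hfg⟩)
    refine ⟨𝓖', h𝓖'.trans h𝓚𝓕, J', hJ'.trans (Finset.erase_subset _ _), ?_, hJ'', hgood'⟩
    calc 𝓕.card ≤ (m + 2) * (Fintype.card (ι × κ) * (C * 𝓖'.card)) := hAcard.trans <|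
          Nat.mul_le_mul_left _ <| hcard.trans <| Nat.mul_le_mul_left _ hcard'
      _ = (m + 2) * (Fintype.card (ι × κ) * C) * 𝓖'.card := by ring
      _ ≤ _ := Nat.mul_le_mul_right _ (Nat.mul_le_mul_left _ (by omega))

/-- In a homogeneous family, the types of agreement are closed under intersection. -/
theorem IsKernelType.agreeSet_eq_inter {ι V : Type*} [Fintype ι] [DecidableEq ι] [DecidableEq V]
    {𝓖 : Finset (ι → V)} {A B : Finset ι} (hA : IsKernelType ι 𝓖 A)
    (hB : IsKernelType ι 𝓖 B) {f : ι → V} (hf : f ∈ 𝓖) :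
    ∃ g ∈ 𝓖, agreeSet f g = A ∩ B := by
  -- Both modifications avoid all values of `f`: `f₁` agrees with `f` exactly on `A`, and `f₂`,
  -- equal to `f₁` on `B`, agrees with `f` exactly on `A ∩ B`.
  obtain ⟨f₁, hf₁, hA₁, hA₁'⟩ := hA f hf f
  obtain ⟨f₂, hf₂, hB₂, hB₂'⟩ := hB f₁ hf₁ f
  refine ⟨f₂, hf₂, ?_⟩
  ext i
  rw [mem_agreeSet, Finset.mem_inter]
  by_cases hiB : i ∈ B
  · rw [hB₂ i hiB]
    by_cases hiA : i ∈ A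
    · simp [hA₁ i hiA, hiA, hiB]
    · simpa [hiA] using (hA₁' i hiA i).symm
  · simpa [hiB] using (hB₂' i hiB i).symm

/-- The Frankl–Füredi bound: a family of functions in which no two members agree on a set `A` of
`s` elements while the values of one of them outside `A` avoid all the values of the other, has
at most `C * #V ^ max s (#ι - s - 1)` members. -/
theorem exists_card_le_mul_pow (ι : Type*) [Fintype ι] [DecidableEq ι] {s : ℕ}
    (hs : s < Fintype.card ι) :
    ∃ C : ℕ, ∀ (V : Type) [Fintype V] [DecidableEq V] [Nonempty V] (𝓕 : Finset (ι → V)),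
      (∀ f ∈ 𝓕, ∀ g ∈ 𝓕, ∀ A : Finset ι, A.card = s → (∀ i ∈ A, g i = f i) →
        ∃ j ∉ A, ∃ k, g j = f k) →
      𝓕.card ≤ C * Fintype.card V ^ max s (Fintype.card ι - s - 1) := by
  have : Nonempty ι := Fintype.card_pos_iff.1 (by omega)
  obtain ⟨C, hC⟩ := exists_homogeneous_subfamily ι ι
    ((Finset.univ : Finset (Finset ι)).erase Finset.univ).card
  refine ⟨C, fun V _ _ _ 𝓕 h𝓕 => ?_⟩
  have hne : ∀ f g : ι → V, f ≠ g → agreeSet f g ≠ Finset.univ := fun f g hfg h =>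
    hfg (funext fun i => mem_agreeSet.1 (h ▸ Finset.mem_univ i))
  obtain ⟨𝓖, h𝓖, J, hJ, hcard, hagree, hker⟩ := hC V _ 𝓕 rfl fun f _ g _ hfg =>
    Finset.mem_erase.2 ⟨hne f g hfg, Finset.mem_univ _⟩
  refine hcard.trans (Nat.mul_le_mul_left _ ?_)
  rcases 𝓖.eq_empty_or_nonempty with rfl | ⟨f₀, hf₀⟩
  · simp
  obtain ⟨T, hT, hTJ⟩ := exists_card_le_forall_not_subset (J := J) hs
    (fun A hA => (Finset.mem_erase.1 (hJ hA)).1)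
    (fun A hA B hB => by
      obtain ⟨g, hg, hgAB⟩ := (hker A hA).agreeSet_eq_inter (hker B hB) hf₀
      rw [← hgAB]
      refine hagree _ hf₀ _ hg ?_
      rintro rfl
      have hAu : A = Finset.univ := by
        rw [← Finset.univ_subset_iff]
        refine subset_trans (fun i _ => ?_) (Finset.inter_subset_left (s₂ := B))
        rw [← hgAB, mem_agreeSet]
      exact (Finset.mem_erase.1 (hJ hA)).1 hAu)
    -- A kernel type of size `s` would let `f₀` be modified outside it while avoiding all its
    -- values, which the hypothesis forbids.
    (fun A hA hAs => by
      obtain ⟨g, hg, h1, h2⟩ := hker A hA f₀ hf₀ f₀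
      obtain ⟨j, hj, k, hk⟩ := h𝓕 f₀ (h𝓖 hf₀) g (h𝓖 hg) A hAs h1
      exact h2 j hj k hk)
  have hinj : Set.InjOn (fun (f : ι → V) (i : {i // i ∈ T}) => f i) (𝓖 : Set (ι → V)) := by
    intro f hf g hg hfg
    by_contra hne
    exact hTJ _ (hagree f hf g hg hne) fun i hi => mem_agreeSet.2 (congrFun hfg ⟨i, hi⟩)
  calc 𝓖.card = (𝓖.image fun (f : ι → V) (i : {i // i ∈ T}) => f i).card :=
        (Finset.card_image_of_injOn hinj).symm
    _ ≤ Fintype.card ({i // i ∈ T} → V) := Finset.card_le_univ _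
    _ = Fintype.card V ^ T.card := by simp
    _ ≤ _ := Nat.pow_le_pow_right Fintype.card_pos hT

/-! ### Copies of `B_{r,s}` and the upper bound. -/

open Classical in
/-- Two labelled copies of `K_r` agreeing on `s` labels and otherwise disjoint span `B_{r,s}`. -/
theorem intersectingCliques_isContained {V : Type*} {G : SimpleGraph V} {r s : ℕ} (hsr : s < r)
    (f g : SimpleGraph.Copy (⊤ : SimpleGraph (Fin r)) G) {A : Finset (Fin r)} (hA : A.card = s)
    (hagree : ∀ i ∈ A, g i = f i) (havoid : ∀ j ∉ A, ∀ k, g j ≠ f k) :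
    (intersectingCliques r s).IsContained G := by
  have hcard : Fintype.card {i : Fin r // r - s ≤ (i : ℕ)} = Fintype.card {i // i ∈ A} := by
    have h1 : Fintype.card {i : Fin r // (i : ℕ) < r - s} = r - s := by
      rw [Fintype.card_subtype, Fin.card_filter_val_lt]; omega
    have h2 := Fintype.card_subtype_compl fun i : Fin r => (i : ℕ) < r - s
    simp only [not_lt] at h2
    rw [h2, h1, Fintype.card_coe, Fintype.card_fin, hA]
    omega
  -- `e` carries the shared positions `r - s, …, r - 1` onto `A`; `a` then wraps the private
  -- vertices `r, …, 2 * r - s - 1` of the second clique round to `0, …, r - s - 1`.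
  let e : Equiv.Perm (Fin r) := (Fintype.equivOfCardEq hcard).extendSubtype
  have he : ∀ i : Fin r, e i ∈ A ↔ r - s ≤ (i : ℕ) := fun i =>
    ⟨fun h => by_contra fun h' => Equiv.extendSubtype_not_mem _ i h' h,
      fun h => Equiv.extendSubtype_mem _ i h⟩
  let a : Fin (2 * r - s) → Fin r := fun v => if h : (v : ℕ) < r then ⟨v, h⟩ else ⟨v - r, by omega⟩
  have ha : ∀ v : Fin (2 * r - s), (v : ℕ) < r → (a v : ℕ) = v := fun v h => by simp [a, h]
  have ha' : ∀ v : Fin (2 * r - s), ¬ (v : ℕ) < r → (a v : ℕ) = v - r := fun v h => by simp [a, h]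
  let h : Fin (2 * r - s) → V := fun v => if (v : ℕ) < r then f (e (a v)) else g (e (a v))
  have hf : ∀ v : Fin (2 * r - s), (v : ℕ) < r → h v = f (e (a v)) := fun v hv => if_pos hv
  have hg : ∀ v : Fin (2 * r - s), r - s ≤ (v : ℕ) → h v = g (e (a v)) := by
    intro v hv
    by_cases hvr : (v : ℕ) < r
    · rw [hf v hvr, hagree _ ((he _).2 (by rw [ha v hvr]; exact hv))]
    · exact if_neg hvr
  have hgA : ∀ v : Fin (2 * r - s), ¬ (v : ℕ) < r → e (a v) ∉ A := by
    intro v hv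
    rw [he, ha' v hv]
    omega
  have haf : ∀ u v : Fin (2 * r - s), u ≠ v → (u : ℕ) < r → (v : ℕ) < r → a u ≠ a v := by
    intro u v huv hu hv h
    have := congrArg Fin.val h
    rw [ha u hu, ha v hv] at this
    exact huv (Fin.ext this)
  have hag : ∀ u v : Fin (2 * r - s), u ≠ v → r - s ≤ (u : ℕ) → r - s ≤ (v : ℕ) → a u ≠ a v := by
    intro u v huv hu hv h
    have := congrArg Fin.val h
    have huv' : (u : ℕ) ≠ v := fun h => huv (Fin.ext h)
    by_cases hur : (u : ℕ) < r <;> by_cases hvr : (v : ℕ) < r <;>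
      simp only [ha, ha', hur, hvr, not_false_eq_true] at this <;> omega
  have hadj : ∀ (c : SimpleGraph.Copy (⊤ : SimpleGraph (Fin r)) G) {i j : Fin r}, i ≠ j →
      G.Adj (c (e i)) (c (e j)) := fun c i j hij =>
    c.toHom.map_adj ((SimpleGraph.top_adj _ _).2 (e.injective.ne hij))
  refine ⟨⟨⟨h, ?_⟩, ?_⟩⟩
  · rintro u v ⟨huv, ⟨hu, hv⟩ | ⟨hu, hv⟩⟩
    · rw [hf u hu, hf v hv]
      exact hadj f (haf u v huv hu hv)
    · rw [hg u hu, hg v hv]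
      exact hadj g (hag u v huv hu hv)
  · intro u v huv
    change h u = h v at huv
    by_contra hne
    by_cases hu : (u : ℕ) < r <;> by_cases hv : (v : ℕ) < r
    · rw [hf u hu, hf v hv] at huv
      exact (hadj f (haf u v hne hu hv)).ne huv
    · rw [hf u hu, hg v (by omega)] at huv
      exact havoid _ (hgA v hv) _ huv.symm
    · rw [hf v hv, hg u (by omega)] at huv
      exact havoid _ (hgA u hu) _ huv
    · rw [hg u (by omega), hg v (by omega)] at huv
      exact (hadj g (hag u v hne (by omega) (by omega))).ne huv

/-- A graph containing `B_{r,s}` has two `r`-cliques meeting in exactly `s` vertices. -/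
theorem exists_isNClique_card_inter_of_isContained {V : Type*} [DecidableEq V] {G : SimpleGraph V}
    {r s : ℕ} (hsr : s < r) (h : (intersectingCliques r s).IsContained G) :
    ∃ S S' : Finset V, G.IsNClique r S ∧ G.IsNClique r S' ∧ (S ∩ S').card = s := by
  obtain ⟨c⟩ := h
  have hinj : Function.Injective c := c.injective
  let P : Finset (Fin (2 * r - s)) := Finset.univ.filter fun v => (v : ℕ) < r
  let Q : Finset (Fin (2 * r - s)) := Finset.univ.filter fun v => r - s ≤ (v : ℕ)
  have hadj : ∀ u v, (intersectingCliques r s).Adj u v → G.Adj (c u) (c v) :=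
    fun u v => c.toHom.map_adj
  have hcompl : (Finset.univ.filter fun v : Fin (2 * r - s) => (v : ℕ) < r - s).card = r - s := by
    rw [Fin.card_filter_val_lt]; omega
  have hP : P.card = r := by
    rw [Fin.card_filter_val_lt]; omega
  have hsplit := Finset.card_filter_add_card_filter_not
    (s := (Finset.univ : Finset (Fin (2 * r - s)))) fun v => (v : ℕ) < r - s
  have hQ : Q.card = r := by
    simp only [not_lt, hcompl, Finset.card_univ, Fintype.card_fin] at hsplit
    change _ + Q.card = _ at hsplit
    omega
  have hPQ : P ∪ Q = Finset.univ := by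
    ext v
    simp only [P, Q, Finset.mem_union, Finset.mem_filter, Finset.mem_univ, true_and, iff_true]
    omega
  have hinter : (P ∩ Q).card = s := by
    have := Finset.card_union_add_card_inter P Q
    rw [hPQ, Finset.card_univ, Fintype.card_fin] at this
    omega
  refine ⟨P.image c, Q.image c, ⟨?_, ?_⟩, ⟨?_, ?_⟩, ?_⟩
  · intro x hx y hy hxy
    obtain ⟨u, hu, rfl⟩ := Finset.mem_image.1 hx
    obtain ⟨v, hv, rfl⟩ := Finset.mem_image.1 hy
    exact hadj u v ⟨fun h => hxy (h ▸ rfl),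
      Or.inl ⟨(Finset.mem_filter.1 hu).2, (Finset.mem_filter.1 hv).2⟩⟩
  · rw [Finset.card_image_of_injective _ hinj, hP]
  · intro x hx y hy hxy
    obtain ⟨u, hu, rfl⟩ := Finset.mem_image.1 hx
    obtain ⟨v, hv, rfl⟩ := Finset.mem_image.1 hy
    exact hadj u v ⟨fun h => hxy (h ▸ rfl),
      Or.inr ⟨(Finset.mem_filter.1 hu).2, (Finset.mem_filter.1 hv).2⟩⟩
  · rw [Finset.card_image_of_injective _ hinj, hQ]
  · rw [← Finset.image_inter _ _ hinj, Finset.card_image_of_injective _ hinj, hinter]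

open Classical in
theorem exists_generalizedTuranNumber_le {r s : ℕ} (hsr : s < r) :
    ∃ C : ℕ, ∀ n, 0 < n →
      generalizedTuranNumber n (⊤ : SimpleGraph (Fin r)) (intersectingCliques r s) ≤
        C * n ^ max s (r - s - 1) := by
  obtain ⟨C, hC⟩ := exists_card_le_mul_pow (Fin r) (s := s) (by simpa using hsr)
  refine ⟨C, fun n hn => Finset.sup_le fun G hG => ?_⟩
  replace hG := (Finset.mem_filter.1 hG).2
  have : Nonempty (Fin n) := ⟨⟨0, hn⟩⟩
  rw [SimpleGraph.copyCount_eq_card_image_copyToSubgraph]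
  refine Finset.card_image_le.trans ?_
  have h := hC (Fin n) (Finset.univ.image
    fun c : SimpleGraph.Copy (⊤ : SimpleGraph (Fin r)) G => (c : Fin r → Fin n)) ?_
  · rw [Finset.card_image_of_injective _ DFunLike.coe_injective, Fintype.card_fin,
      Fintype.card_fin] at h
    exact h
  · intro f hf g hg A hA hagree
    obtain ⟨f, -, rfl⟩ := Finset.mem_image.1 hf
    obtain ⟨g, -, rfl⟩ := Finset.mem_image.1 hg
    by_contra! havoid
    exact hG (intersectingCliques_isContained hsr f g hA hagree havoid)

/-! ### Block graphs and the lower bounds. -/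

/-- The graph on `Fin n` in which the vertex `v` has colour `v % r` and block `v / r`, adjacent
vertices have distinct colours, vertices whose colours have the same image under `σ` have to share
their block to be adjacent, and vertices with a colour in `R` are isolated outside block `0`. -/
def blockGraph {ι : Type*} (n : ℕ) {r : ℕ} [NeZero r] (σ : Fin r → ι) (R : Finset (Fin r)) :
    SimpleGraph (Fin n) where
  Adj v w := Fin.ofNat r v ≠ Fin.ofNat r w ∧
    (σ (Fin.ofNat r v) = σ (Fin.ofNat r w) → (v : ℕ) / r = w / r) ∧
    (Fin.ofNat r v ∈ R → (v : ℕ) / r = 0) ∧ (Fin.ofNat r w ∈ R → (w : ℕ) / r = 0)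
  symm := ⟨fun _ _ h => ⟨h.1.symm, fun h' => (h.2.1 h'.symm).symm, h.2.2.symm⟩⟩
  loopless := ⟨fun _ h => h.1 rfl⟩

theorem eq_of_ofNat_eq_of_div_eq {r : ℕ} [NeZero r] {a b : ℕ}
    (h : Fin.ofNat r a = Fin.ofNat r b) (h' : a / r = b / r) : a = b := by
  have h1 : a % r = b % r := congrArg Fin.val h
  rw [← Nat.div_add_mod a r, ← Nat.div_add_mod b r, h1, h']

/-- The colours of the common vertices of two `r`-cliques of `blockGraph n σ R` form a set which
contains `R` and is saturated with respect to `σ`. -/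
theorem exists_saturated_card_eq_card_inter {ι : Type*} {n r : ℕ} [NeZero r] (hr : 1 < r)
    {σ : Fin r → ι} {R : Finset (Fin r)} {S S' : Finset (Fin n)}
    (hS : (blockGraph n σ R).IsNClique r S) (hS' : (blockGraph n σ R).IsNClique r S') :
    ∃ I : Finset (Fin r), I.card = (S ∩ S').card ∧ R ⊆ I ∧ ∀ i ∈ I, ∀ j, σ i = σ j → j ∈ I := by
  have hinj : ∀ S : Finset (Fin n), (blockGraph n σ R).IsNClique r S →
      Set.InjOn (fun v : Fin n => Fin.ofNat r v) S := by
    intro S hS v hv w hw hvw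
    by_contra hne
    exact (hS.1 hv hw hne).1 hvw
  have hsurj : ∀ S : Finset (Fin n), (blockGraph n σ R).IsNClique r S →
      ∀ i, ∃ v ∈ S, Fin.ofNat r v = i := by
    intro S hS i
    have : S.image (fun v : Fin n => Fin.ofNat r v) = Finset.univ := by
      rw [← Finset.card_eq_iff_eq_univ, Finset.card_image_of_injOn (hinj S hS), hS.2,
        Fintype.card_fin]
    exact Finset.mem_image.1 (this ▸ Finset.mem_univ i)
  have hblock : ∀ S : Finset (Fin n), (blockGraph n σ R).IsNClique r S →
      ∀ v ∈ S, ∀ w ∈ S, σ (Fin.ofNat r v) = σ (Fin.ofNat r w) → (v : ℕ) / r = w / r := by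
    intro S hS v hv w hw hvw
    by_cases hne : v = w
    · rw [hne]
    · exact (hS.1 hv hw hne).2.1 hvw
  have hzero : ∀ S : Finset (Fin n), (blockGraph n σ R).IsNClique r S →
      ∀ v ∈ S, Fin.ofNat r v ∈ R → (v : ℕ) / r = 0 := by
    intro S hS v hv hvR
    -- The restriction on colours in `R` is only felt through an edge, so a second vertex of the
    -- clique is needed.
    obtain ⟨w, hw, hwv⟩ := Finset.exists_mem_ne (hS.2 ▸ hr) v
    exact (hS.1 hv hw hwv.symm).2.2.1 hvR
  refine ⟨(S ∩ S').image fun v : Fin n => Fin.ofNat r v, ?_, fun i hi => ?_, fun i hi j hij => ?_⟩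
  · exact Finset.card_image_of_injOn ((hinj S hS).mono (by simp))
  · obtain ⟨v, hv, rfl⟩ := hsurj S hS i
    obtain ⟨w, hw, hwv⟩ := hsurj S' hS' (Fin.ofNat r v)
    have : w = v := Fin.ext <| eq_of_ofNat_eq_of_div_eq hwv <|
      (hzero S' hS' w hw (hwv ▸ hi)).trans (hzero S hS v hv hi).symm
    exact Finset.mem_image.2 ⟨v, Finset.mem_inter.2 ⟨hv, this ▸ hw⟩, rfl⟩
  · obtain ⟨u, hu, rfl⟩ := Finset.mem_image.1 hi
    obtain ⟨hu, hu'⟩ := Finset.mem_inter.1 hu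
    obtain ⟨v, hv, rfl⟩ := hsurj S hS j
    obtain ⟨w, hw, hwv⟩ := hsurj S' hS' (Fin.ofNat r v)
    have : w = v := Fin.ext <| eq_of_ofNat_eq_of_div_eq hwv <|
      (hblock S' hS' u hu' w hw (hwv ▸ hij)).symm.trans (hblock S hS u hu v hv hij)
    exact Finset.mem_image.2 ⟨v, Finset.mem_inter.2 ⟨hv, this ▸ hw⟩, rfl⟩

open Classical in
/-- Compatible choices of a block for every colour give distinct `r`-cliques of `blockGraph`. -/
theorem card_le_copyCount_blockGraph {ι X : Type*} [Fintype X] {n r : ℕ} [NeZero r]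
    {σ : Fin r → ι} {R : Finset (Fin r)} {Φ : X → Fin r → Fin (n / r)}
    (hΦ : Function.Injective Φ) (hσ : ∀ x i j, σ i = σ j → Φ x i = Φ x j)
    (hR : ∀ x, ∀ i ∈ R, (Φ x i : ℕ) = 0) :
    Fintype.card X ≤ (blockGraph n σ R).copyCount (⊤ : SimpleGraph (Fin r)) := by
  have hlt : ∀ (x : X) (i : Fin r), r * (Φ x i : ℕ) + i < n := by
    intro x i
    calc r * (Φ x i : ℕ) + i < r * (Φ x i + 1) := by rw [mul_add]; omega
      _ ≤ r * (n / r) := Nat.mul_le_mul_left _ (Φ x i).2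
      _ ≤ n := Nat.mul_div_le n r
  let f : X → Fin r → Fin n := fun x i => ⟨r * (Φ x i : ℕ) + i, hlt x i⟩
  have hcol : ∀ x i, Fin.ofNat r (f x i : ℕ) = i := fun x i => Fin.ext <| by
    change (r * (Φ x i : ℕ) + i) % r = i
    rw [Nat.mul_add_mod, Nat.mod_eq_of_lt i.2]
  have hdiv : ∀ x i, (f x i : ℕ) / r = Φ x i := fun x i => by
    change (r * (Φ x i : ℕ) + i) / r = Φ x i
    rw [Nat.mul_add_div (NeZero.pos r), Nat.div_eq_of_lt i.2, add_zero]
  let c : X → SimpleGraph.Copy (⊤ : SimpleGraph (Fin r)) (blockGraph n σ R) := fun x =>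
    ⟨⟨f x, fun {i j} hij => by
      refine ⟨?_, ?_, ?_, ?_⟩
      · rw [hcol, hcol]; exact (SimpleGraph.top_adj _ _).1 hij
      · rw [hcol, hcol, hdiv, hdiv]; exact fun h => congrArg Fin.val (hσ x i j h)
      · rw [hcol, hdiv]; exact hR x i
      · rw [hcol, hdiv]; exact hR x j⟩,
      fun i j hij => by rw [← hcol x i, ← hcol x j]; exact congrArg (fun v : Fin n => Fin.ofNat r v) hij⟩
  rw [SimpleGraph.copyCount_eq_card_image_copyToSubgraph, ← Finset.card_univ]
  refine Finset.card_le_card_of_injOn (fun x => (c x).toSubgraph)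
    (fun x _ => Finset.mem_coe.2 (Finset.mem_image_of_mem _ (Finset.mem_univ _)))
    fun x _ y _ hxy => hΦ (funext fun i => Fin.ext ?_)
  -- The vertex set alone recovers the block choices, since colours identify the labels; so distinct
  -- choices give distinct unlabelled copies.
  have hverts : Set.range (f x) = Set.range (f y) := by
    have := congrArg SimpleGraph.Subgraph.verts hxy
    simpa [c, SimpleGraph.Subgraph.map_verts] using! this
  obtain ⟨j, hj⟩ : f x i ∈ Set.range (f y) := hverts ▸ Set.mem_range_self i
  have hij : j = i := by rw [← hcol x i, ← hj, hcol]
  rw [← hdiv, ← hdiv, ← hj, hij]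

/-- If no `σ`-saturated set of colours containing `R` has exactly `s` elements, then the compatible
choices of blocks bound `ex(n, K_r, B_{r,s})` from below. -/
theorem card_le_generalizedTuranNumber {ι X : Type*} [Fintype X] {n r s : ℕ} [NeZero r]
    (hr : 1 < r) (hsr : s < r) {σ : Fin r → ι} {R : Finset (Fin r)}
    (hsat : ∀ I : Finset (Fin r), R ⊆ I → (∀ i ∈ I, ∀ j, σ i = σ j → j ∈ I) → I.card ≠ s)
    {Φ : X → Fin r → Fin (n / r)}
    (hΦ : Function.Injective Φ) (hσ : ∀ x i j, σ i = σ j → Φ x i = Φ x j)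
    (hR : ∀ x, ∀ i ∈ R, (Φ x i : ℕ) = 0) :
    Fintype.card X ≤
      generalizedTuranNumber n (⊤ : SimpleGraph (Fin r)) (intersectingCliques r s) := by
  classical
  refine (card_le_copyCount_blockGraph hΦ hσ hR).trans ?_
  unfold generalizedTuranNumber
  refine Finset.le_sup (f := fun G : SimpleGraph (Fin n) => G.copyCount (⊤ : SimpleGraph (Fin r)))
    (Finset.mem_filter.2 ⟨Finset.mem_univ _, fun hcon => ?_⟩)
  obtain ⟨S, S', hS, hS', hcard⟩ := exists_isNClique_card_inter_of_isContained hsr hcon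
  obtain ⟨I, hI, hRI, hsatI⟩ := exists_saturated_card_eq_card_inter hr hS hS'
  exact hsat I hRI hsatI (hI.trans hcard)

/-- The lower bound given by `r - s - 1` independent sets joined to a clique of size `s + 1`. -/
theorem div_pow_le_generalizedTuranNumber {n r s : ℕ} (hs : 1 ≤ s) (hsr : s < r) (hn : r ≤ n) :
    (n / r) ^ (r - s - 1) ≤
      generalizedTuranNumber n (⊤ : SimpleGraph (Fin r)) (intersectingCliques r s) := by
  have : NeZero r := ⟨by omega⟩
  have : NeZero (n / r) := ⟨(Nat.div_pos hn (NeZero.pos r)).ne'⟩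
  -- With `s + 1` frozen colours, any two cliques share more than `s` vertices.
  let R : Finset (Fin r) := Finset.univ.filter fun i => (i : ℕ) < s + 1
  have hRcard : R.card = s + 1 := by
    rw [Fin.card_filter_val_lt]; omega
  have h := card_le_generalizedTuranNumber (X := {i // i ∉ R} → Fin (n / r)) (n := n)
    (by omega) hsr (σ := id) (R := R)
    (fun I hI _ hcard => by have := Finset.card_le_card hI; omega)
    (Φ := fun x i => if h : i ∈ R then 0 else x ⟨i, h⟩)
    (fun x y hxy => funext fun i => by simpa [i.2] using congrFun hxy i)
    (fun x i j hij => by rw [show i = j from hij])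
    (fun x i hi => by simp [hi])
  have hcard : Fintype.card {i // i ∉ R} = r - s - 1 := by
    rw [Fintype.card_subtype_compl, Fintype.card_coe, hRcard, Fintype.card_fin]; omega
  rwa [Fintype.card_fun, hcard, Fintype.card_fin] at h

/-- The lower bound given by a sum-free partition. -/
theorem div_pow_card_parts_le_generalizedTuranNumber {n r s : ℕ} (hs : 1 ≤ s) (hsr : s < r)
    {P : r.Partition} (hP : P.IsSumFree s) :
    (n / r) ^ P.parts.card ≤
      generalizedTuranNumber n (⊤ : SimpleGraph (Fin r)) (intersectingCliques r s) := by
  classical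
  have : NeZero r := ⟨by omega⟩
  have hsum : ∑ x : P.parts, (x : ℕ) = r := by
    rw [Finset.sum, Multiset.map_univ_coe, P.parts_sum]
  have hcard : Fintype.card ((x : P.parts) × Fin x) = Fintype.card (Fin r) := by
    simp [hsum]
  let e := Fintype.equivOfCardEq hcard
  -- The `σ`-classes have the parts as sizes, so a saturated set has the sum of a subfamily of parts
  -- as its size.
  let σ : Fin r → P.parts := fun i => (e.symm i).1
  have hfibre : ∀ x, (Finset.univ.filter fun i => σ i = x).card = (x : ℕ) := by
    intro x
    rw [← Fintype.card_fin (x : ℕ), ← Finset.card_univ]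
    symm
    refine Finset.card_bij (fun k _ => e ⟨x, k⟩) (fun k _ => by simp [σ])
      (fun k _ l _ hkl => by simpa using hkl) fun i hi => ?_
    obtain ⟨⟨y, k⟩, rfl⟩ := e.surjective i
    obtain rfl : y = x := by simpa [σ] using hi
    exact ⟨k, Finset.mem_univ _, rfl⟩
  have hσ : Function.Surjective σ := fun x =>
    ⟨e ⟨x, ⟨0, P.parts_pos (Multiset.coe_mem)⟩⟩, by simp [σ]⟩
  have h := card_le_generalizedTuranNumber (X := P.parts → Fin (n / r)) (n := n)
    (by omega) hsr (σ := σ) (R := ∅)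
    (fun I _ hI hIs => by
      refine hP ((I.image σ).val.map fun x : P.parts => (x : ℕ)) ?_ ?_
      · calc (I.image σ).val.map (fun x : P.parts => (x : ℕ)) ≤
              (Finset.univ : Finset P.parts).val.map fun x : P.parts => (x : ℕ) :=
              Multiset.map_le_map (Finset.val_le_iff.2 (Finset.subset_univ _))
          _ = P.parts := Multiset.map_univ_coe _
      · rw [← hIs, Finset.card_eq_sum_card_image σ I]
        refine Finset.sum_congr rfl fun x hx => ?_
        rw [← hfibre x]
        congr 1
        ext i
        obtain ⟨j, hj, rfl⟩ := Finset.mem_image.1 hx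
        simp only [Finset.mem_filter, Finset.mem_univ, true_and]
        exact ⟨fun h => ⟨hI j hj i h.symm, h⟩, fun h => h.2⟩)
    (Φ := fun x i => x (σ i))
    (fun x y hxy => funext fun a => by
      obtain ⟨i, rfl⟩ := hσ a
      exact congrFun hxy i)
    (fun x i j hij => by rw [hij])
    (fun x i hi => absurd hi (Finset.notMem_empty i))
  rwa [Fintype.card_fun, Fintype.card_fin, Multiset.card_coe] at h

theorem div_pow_maxSumFreeLength_le_generalizedTuranNumber {n r s : ℕ} (hs : 1 ≤ s) (hsr : s < r) :
    (n / r) ^ maxSumFreeLength r s ≤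
      generalizedTuranNumber n (⊤ : SimpleGraph (Fin r)) (intersectingCliques r s) := by
  classical
  -- The one-part partition is sum-free because `0 < s < r`, so the supremum is attained.
  have hne : (Finset.univ.filter fun P : r.Partition => P.IsSumFree s).Nonempty := by
    refine ⟨Nat.Partition.indiscrete r, Finset.mem_filter.2 ⟨Finset.mem_univ _, fun t ht => ?_⟩⟩
    rw [Nat.Partition.indiscrete_parts (by omega), Multiset.le_singleton] at ht
    rcases ht with rfl | rfl
    · simp; omega
    · simp; omega
  obtain ⟨P, hP, hPmax⟩ := Finset.exists_mem_eq_sup _ hne fun P : r.Partition => P.parts.card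
  have : maxSumFreeLength r s = P.parts.card := by
    rw [← hPmax]; unfold maxSumFreeLength; congr!
  rw [this]
  exact div_pow_card_parts_le_generalizedTuranNumber hs hsr (Finset.mem_filter.1 hP).2

/-- For `n ≥ r`, rounding `n / r` down costs at most a factor 2. -/
theorem mul_pow_le_cast_div_pow {n r : ℕ} (hr : 0 < r) (hn : r ≤ n) (k : ℕ) :
    ((2 * r : ℝ)⁻¹) ^ k * (n : ℝ) ^ k ≤ (((n / r) ^ k : ℕ) : ℝ) := by
  rw [← mul_pow, Nat.cast_pow]
  refine pow_le_pow_left₀ (by positivity) ?_ k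
  have h1 : n ≤ 2 * r * (n / r) := by
    have := Nat.lt_mul_div_succ n hr
    have : r * 1 ≤ r * (n / r) := Nat.mul_le_mul_left r (Nat.div_pos hn hr)
    nlinarith
  rw [inv_mul_le_iff₀ (by positivity)]
  exact_mod_cast h1

theorem theorem1p6 (r s : ℕ) (hs : 2 ≤ s) (hsr : s < r) :
    (2 * s + 1 ≤ r →
      (fun n : ℕ => (generalizedTuranNumber n (⊤ : SimpleGraph (Fin r))
          (intersectingCliques r s) : ℝ))
        =Θ[atTop] fun n : ℕ => (n : ℝ) ^ (r - s - 1)) ∧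
    (r ≤ 2 * s →
      ∃ c₁ c₂ : ℝ, 0 < c₁ ∧ 0 < c₂ ∧ ∀ n : ℕ, r ≤ n →
        c₁ * (n : ℝ) ^ maxSumFreeLength r s ≤
            (generalizedTuranNumber n (⊤ : SimpleGraph (Fin r)) (intersectingCliques r s) : ℝ) ∧
        (generalizedTuranNumber n (⊤ : SimpleGraph (Fin r)) (intersectingCliques r s) : ℝ) ≤
            c₂ * (n : ℝ) ^ s) := by
  obtain ⟨C, hC⟩ := exists_generalizedTuranNumber_le hsr
  have hr : 0 < r := by omega
  constructor
  · intro hrs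
    rw [max_eq_right (by omega)] at hC
    constructor
    · refine IsBigO.of_bound C ?_
      filter_upwards [eventually_ge_atTop r] with n hn
      rw [Real.norm_of_nonneg (by positivity), Real.norm_of_nonneg (by positivity)]
      exact_mod_cast hC n (by omega)
    · refine IsBigO.of_bound (((2 * r : ℝ)⁻¹ ^ (r - s - 1))⁻¹) ?_
      filter_upwards [eventually_ge_atTop r] with n hn
      rw [Real.norm_of_nonneg (by positivity), Real.norm_of_nonneg (by positivity),
        le_inv_mul_iff₀ (by positivity)]
      exact (mul_pow_le_cast_div_pow hr hn _).trans
        (by exact_mod_cast div_pow_le_generalizedTuranNumber (by omega) hsr hn)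
  · intro hrs
    rw [max_eq_left (by omega)] at hC
    -- `C + 1` because `C` might be 0.
    refine ⟨(2 * r : ℝ)⁻¹ ^ maxSumFreeLength r s, C + 1, by positivity, by positivity,
      fun n hn => ⟨?_, ?_⟩⟩
    · exact (mul_pow_le_cast_div_pow hr hn _).trans
        (by exact_mod_cast div_pow_maxSumFreeLength_le_generalizedTuranNumber (by omega) hsr)
    · have h : (generalizedTuranNumber n (⊤ : SimpleGraph (Fin r)) (intersectingCliques r s) : ℝ) ≤
          C * (n : ℝ) ^ s := by exact_mod_cast hC n (by omega)
      refine h.trans (mul_le_mul_of_nonneg_right (by linarith) (by positivity))
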